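/- Let $G$ be a finite group and let $\mathcal{C}\subseteq G$ be a subset stable under conjugation. On the complex vector space $\mathbb{C}\mathcal{C}$ with basis $\mathcal{C}$, let $[-,-]$ be the bilinear extension of $[a,b]=aba^{-1}$ ($a,b\in\mathcal{C}$). The Killing form of $\mathcal{C}$ is the bilinear form $K_{\mathcal{C}}:\mathbb{C}\mathcal{C}\times\mathbb{C}\mathcal{C}\to\mathbb{C}$ given by $K_{\mathcal{C}}(x,y)=\mathrm{Tr}\big([x,[y,-]]\big)$; thus $K_{\mathcal{C}}(a,b)=|C_G(ab)\cap\mathcal{C}|$ for $a,b\in\mathcal{C}$. A conjugacy class is called real if it is stable under inversion. **Theorem.** Let $q$ be a prime power and let $\mathcal{C}$ be a real conjugacy class of $\mathrm{PSL}_2(q)=\mathrm{SL}_2(\mathbb{F}_q)/Z(\mathrm{SL}_2(\mathbb{F}_q))$. Then the Killing form $K_{\mathcal{C}}$ is non-degenerate, unless $q=2$ and $\mathcal{C}$ is the class of elements of order $3$, or $q=3$ and $\mathcal{C}$ is the class of elements of order $2$. -/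

import Mathlib

/-- The bracket `[x, -]` on the space `ℂC` with basis a conjugation-stable subset `C` of a group `G`:
the bilinear extension of `[a, b] = a * b * a⁻¹` for `a, b ∈ C`. -/
noncomputable def groupBracket {G : Type*} [Group G] (C : Set G)
    (hC : ∀ g : G, ∀ x ∈ C, g * x * g⁻¹ ∈ C) :
    (C →₀ ℂ) →ₗ[ℂ] (C →₀ ℂ) →ₗ[ℂ] (C →₀ ℂ) :=
  Finsupp.linearCombination ℂ fun a : C =>
    Finsupp.lmapDomain ℂ ℂ fun b : C => (⟨a * b * (a : G)⁻¹, hC a b b.2⟩ : C)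

/-- The Killing form on a conjugation-stable subset `C` of a (finite) group `G`: the bilinear form
`(x, y) ↦ Tr [x, [y, -]]` on `ℂC`. -/
noncomputable def groupKillingForm {G : Type*} [Group G] (C : Set G)
    (hC : ∀ g : G, ∀ x ∈ C, g * x * g⁻¹ ∈ C) : LinearMap.BilinForm ℂ (C →₀ ℂ) :=
  ((LinearMap.mul ℂ (Module.End ℂ (C →₀ ℂ))).compl₁₂
    (groupBracket C hC) (groupBracket C hC)).compr₂ (LinearMap.trace ℂ (C →₀ ℂ))

theorem groupBracket_single_single {G : Type*} [Group G] (C : Set G)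
    (hC : ∀ g : G, ∀ x ∈ C, g * x * g⁻¹ ∈ C) (a b : C) :
    groupBracket C hC (Finsupp.single a 1) (Finsupp.single b 1) =
      Finsupp.single (⟨a * b * (a : G)⁻¹, hC a b b.2⟩ : C) 1 := by
  simp [groupBracket, Finsupp.lmapDomain_apply, Finsupp.mapDomain_single]

theorem groupKillingForm_apply {G : Type*} [Group G] (C : Set G)
    (hC : ∀ g : G, ∀ x ∈ C, g * x * g⁻¹ ∈ C) (x y : C →₀ ℂ) :
    groupKillingForm C hC x y =
      LinearMap.trace ℂ (C →₀ ℂ) (groupBracket C hC x ∘ₗ groupBracket C hC y) :=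
  rfl

/-- On basis elements, the Killing form counts the elements of `C` that commute with `a * b`. -/
theorem groupKillingForm_single_single {G : Type*} [Group G] [Finite G] (C : Set G)
    (hC : ∀ g : G, ∀ x ∈ C, g * x * g⁻¹ ∈ C) (a b : C) :
    groupKillingForm C hC (Finsupp.single a 1) (Finsupp.single b 1) =
      (Set.ncard (((Subgroup.centralizer {(a * b : G)} : Subgroup G) : Set G) ∩ C) : ℂ) := by
  classical
  have : Fintype C := Fintype.ofFinite C
  rw [groupKillingForm_apply, LinearMap.trace_eq_matrix_trace ℂ Finsupp.basisSingleOne]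
  have key : ∀ x : C, (a * (b * x * (b : G)⁻¹) * (a : G)⁻¹ = x) ↔
      (x : G) ∈ Subgroup.centralizer {(a * b : G)} := by
    intro x
    rw [Subgroup.mem_centralizer_singleton_iff]
    constructor
    · intro h
      rw [mul_inv_eq_iff_eq_mul] at h
      have := congrArg (· * (b : G)) h
      simp only [mul_assoc, inv_mul_cancel, mul_one] at this
      simp only [mul_assoc]
      first | exact this | exact this.symm
    · intro h
      rw [mul_inv_eq_iff_eq_mul, ← mul_assoc, ← mul_assoc, mul_inv_eq_iff_eq_mul]
      simp only [mul_assoc] at h ⊢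
      first | exact h | exact h.symm
  have hd : ∀ x : C, (LinearMap.toMatrix Finsupp.basisSingleOne Finsupp.basisSingleOne
      (groupBracket C hC (Finsupp.single a 1) ∘ₗ groupBracket C hC (Finsupp.single b 1))) x x =
      if (x : G) ∈ Subgroup.centralizer {(a * b : G)} then (1 : ℂ) else 0 := by
    intro x
    rw [LinearMap.toMatrix_apply]
    simp only [Finsupp.coe_basisSingleOne, LinearMap.comp_apply, groupBracket_single_single,
      Finsupp.basisSingleOne_repr, LinearEquiv.refl_apply, Finsupp.single_apply, Subtype.ext_iff,
      key]
  simp only [Matrix.trace, Matrix.diag_apply, hd, Finset.sum_boole]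
  norm_cast
  rw [← Set.ncard_coe_finset, ← Set.ncard_image_of_injective _ Subtype.val_injective]
  congr 1
  ext g
  simp [and_comm]

/-- A conjugacy class is stable under conjugation. -/
theorem ConjClasses.conj_mem_carrier {G : Type*} [Group G] (C : ConjClasses G) :
    ∀ g : G, ∀ x ∈ C.carrier, g * x * g⁻¹ ∈ C.carrier := by
  intro g x hx
  rw [ConjClasses.mem_carrier_iff_mk_eq] at hx ⊢
  rw [← hx, ConjClasses.mk_eq_mk_iff_isConj, isConj_comm]
  exact isConj_iff.2 ⟨g, rfl⟩

/-- The Killing form on a conjugacy class. -/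
noncomputable def ConjClasses.killingForm {G : Type*} [Group G] (C : ConjClasses G) :
    LinearMap.BilinForm ℂ (C.carrier →₀ ℂ) :=
  groupKillingForm C.carrier C.conj_mem_carrier

/-- A conjugacy class is real if it is stable under inversion. -/
def ConjClasses.IsReal {G : Type*} [Group G] (C : ConjClasses G) : Prop :=
  ∀ a ∈ C.carrier, a⁻¹ ∈ C.carrier

/-! ### Radical of the Killing form of a real class -/

section KillingForm

variable {G : Type*} [Group G] (C : Set G) (hC : ∀ g : G, ∀ x ∈ C, g * x * g⁻¹ ∈ C)

/-! For a real class, the operators `[x, -]` are closed under the Hermitian adjoint. If `x` is in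
the radical and `X = [x, -]`, pairing `x` with the `y` such that `[y, -] = X*` gives `Tr (X X*) =
0`, so `X = 0`. Non-degeneracy thus reduces to faithfulness of the bracket
(`groupKillingForm_nondegenerate`).

If `[x, -] = 0`, then for all `c, d` in the class the coefficients of `x` at the `b` with `b c b⁻¹ =
d` sum to zero. If `d = a c a⁻¹` has the single solution `a`, conjugation kills every coefficient.
If there are two solutions `a` and `u a u⁻¹`, conjugating by the powers of `u` flips a sign at each
step, and odd order of `u` kills the coefficients again
(`ConjClasses.killingForm_nondegenerate_of_odd`).

In `PSL₂`, write `b = a g`: `g` commutes with `c` up to sign and `tr (a g) = tr a`. When `g`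
commutes with `c` it is a combination of `1` and `c`, subject to a linear trace condition and to the
quadratic condition `det g = 1`, so few solutions remain besides `g = 1`. Each type of class gets a
pair `a, c` for which one of the two situations occurs. -/

open Classical in
theorem groupBracket_apply_single [Fintype C] (x : C →₀ ℂ) (c d : C) :
    groupBracket C hC x (Finsupp.single c 1) d =
      ∑ a : C, if (a : G) * c * (a : G)⁻¹ = d then x a else 0 := by
  classical
  rw [groupBracket, Finsupp.linearCombination_apply, Finsupp.sum_fintype _ _ (by simp)]
  simp [Finsupp.lmapDomain_apply, Finsupp.mapDomain_single, Finsupp.finsetSum_apply,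
    Finsupp.single_apply, Subtype.ext_iff]

theorem groupKillingForm_isSymm : LinearMap.IsSymm (groupKillingForm C hC) := by
  refine ⟨fun x y => ?_⟩
  simp only [RingHom.id_apply, groupKillingForm_apply]
  exact LinearMap.trace_mul_comm ℂ (groupBracket C hC x) (groupBracket C hC y)

/-- If `C` is stable under inversion, then the Killing form of `C` is non-degenerate as soon as
the bracket is faithful: the adjoint of the operator `[x, -]` is again of the form `[y, -]`. -/
theorem groupKillingForm_nondegenerate [Finite G] (hinv : ∀ a ∈ C, a⁻¹ ∈ C)
    (hinj : ∀ x : C →₀ ℂ, groupBracket C hC x = 0 → x = 0) :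
    (groupKillingForm C hC).Nondegenerate := by
  classical
  have : Fintype C := Fintype.ofFinite C
  refine ((groupKillingForm_isSymm C hC).isRefl.nondegenerate_iff_separatingLeft).2 fun x hx => ?_
  apply hinj
  let inv : C ≃ C :=
    ⟨fun a => ⟨(a : G)⁻¹, hinv a a.2⟩, fun a => ⟨(a : G)⁻¹, hinv a a.2⟩,
      fun a => by simp, fun a => by simp⟩
  -- `[a, -]` is a permutation matrix with transpose `[a⁻¹, -]`, so the adjoint of `[x, -]` inverts
  -- the group elements and conjugates the coefficients.
  let y : C →₀ ℂ := Finsupp.equivFunOnFinite.symm fun a => star (x (inv a))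
  let b : Module.Basis C ℂ (C →₀ ℂ) := Finsupp.basisSingleOne
  have hy : LinearMap.toMatrix b b (groupBracket C hC y) =
      (LinearMap.toMatrix b b (groupBracket C hC x)).conjTranspose := by
    ext d c
    rw [Matrix.conjTranspose_apply, LinearMap.toMatrix_apply, LinearMap.toMatrix_apply]
    simp only [b, Finsupp.coe_basisSingleOne, Finsupp.basisSingleOne_repr,
      LinearEquiv.refl_apply, groupBracket_apply_single, star_sum]
    rw [← Equiv.sum_comp inv]
    refine Finset.sum_congr rfl fun a _ => ?_
    have h1 : y (inv a) = star (x a) := by simp [y, inv]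
    have h2 : ((inv a : C) : G) * c * ((inv a : C) : G)⁻¹ = d ↔ (a : G) * d * (a : G)⁻¹ = c := by
      constructor
      · intro h
        rw [← h]
        simp [inv, mul_assoc]
      · intro h
        rw [← h]
        simp [inv, mul_assoc]
    simp only [h1, h2, apply_ite (star : ℂ → ℂ), star_zero]
  have ht := hx y
  rw [groupKillingForm_apply, LinearMap.trace_eq_matrix_trace ℂ b, LinearMap.toMatrix_comp b b b,
    hy] at ht
  open ComplexOrder in
  rw [Matrix.trace_mul_conjTranspose_self_eq_zero_iff] at ht
  exact (LinearMap.toMatrix b b).map_eq_zero_iff.1 ht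

end KillingForm

/-! ### The odd-cycle criterion -/

/-- Suppose that `a, c, u a u⁻¹` lie in the real class `C`, that `u` has odd order, and that only
`a` and possibly `u a u⁻¹` conjugate `c` to `a c a⁻¹`. Then the Killing form is non-degenerate. -/
theorem ConjClasses.killingForm_nondegenerate_of_odd {G : Type*} [Group G] [Finite G]
    (C : ConjClasses G) (hC : C.IsReal) {a c u : G} (ha : a ∈ C.carrier) (hc : c ∈ C.carrier)
    (hu : Odd (orderOf u))
    (h : ∀ b ∈ C.carrier, b * c * b⁻¹ = a * c * a⁻¹ → b = a ∨ b = u * a * u⁻¹) :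
    C.killingForm.Nondegenerate := by
  classical
  have : Fintype C.carrier := Fintype.ofFinite _
  refine groupKillingForm_nondegenerate _ _ hC fun x hx => ?_
  -- The class is parametrised, with repetitions, by the conjugators of `a`.
  let f : G → C.carrier := fun k => ⟨k * a * k⁻¹, C.conj_mem_carrier k a ha⟩
  have hsum (k : G) : ∑ b : C.carrier,
      (if (b : G) * (k * c * k⁻¹) * (b : G)⁻¹ = k * (a * c * a⁻¹) * k⁻¹ then x b else 0) = 0 := by
    have := groupBracket_apply_single C.carrier C.conj_mem_carrier x
      ⟨k * c * k⁻¹, C.conj_mem_carrier k c hc⟩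
      ⟨k * (a * c * a⁻¹) * k⁻¹, C.conj_mem_carrier k _ (C.conj_mem_carrier a c hc)⟩
    rw [hx] at this
    simpa using this.symm
  have hself (k : G) :
      (f k : G) * (k * c * k⁻¹) * (f k : G)⁻¹ = k * (a * c * a⁻¹) * k⁻¹ := by
    simp [f, mul_assoc]
  have hconj {k : G} {b : C.carrier}
      (hb : (b : G) * (k * c * k⁻¹) * (b : G)⁻¹ = k * (a * c * a⁻¹) * k⁻¹) :
      (k⁻¹ * b * k⁻¹⁻¹) * c * (k⁻¹ * b * k⁻¹⁻¹)⁻¹ = a * c * a⁻¹ := by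
    have := congrArg (fun z => k⁻¹ * z * k) hb
    simpa [mul_assoc] using this
  have hback {k v : G} {b : C.carrier} (hb : k⁻¹ * b * k⁻¹⁻¹ = v * a * v⁻¹) : b = f (k * v) := by
    apply Subtype.ext
    have := congrArg (fun z => k * z * k⁻¹) hb
    simpa [mul_assoc, f] using this
  have key (k : G) : x (f k) = 0 := by
    -- In the negative case `u a u⁻¹` is either `a` itself or not a solution, so the sum has one
    -- term only.
    by_cases hp : u * a * u⁻¹ ≠ a ∧ (u * a * u⁻¹) * c * (u * a * u⁻¹)⁻¹ = a * c * a⁻¹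
    · have hstep (k : G) : x (f (k * u)) = -x (f k) := by
        have hne : f k ≠ f (k * u) := fun h' => hp.1 <| by
          have := congrArg (fun z => k⁻¹ * z * k) (congrArg Subtype.val h')
          simpa [mul_assoc, f] using this.symm
        rw [eq_neg_iff_add_eq_zero, add_comm, ← hsum k, Fintype.sum_eq_add _ _ hne, if_pos (hself k),
          if_pos]
        · have := congrArg (fun z => k * z * k⁻¹) hp.2
          simpa [mul_assoc, f] using this
        · rintro b ⟨hb1, hb2⟩
          refine if_neg fun h' => ?_
          rcases h _ (C.conj_mem_carrier k⁻¹ b b.2) (hconj h') with h3 | h3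
          · exact hb1 (by simpa using hback (v := 1) (by simpa using h3))
          · exact hb2 (hback h3)
      have hpow (i : ℕ) : x (f (k * u ^ i)) = (-1) ^ i * x (f k) := by
        induction i with
        | zero => simp
        | succ i ih => rw [pow_succ, ← mul_assoc, hstep, ih]; ring
      have := hpow (orderOf u)
      rw [pow_orderOf_eq_one, mul_one, hu.neg_one_pow] at this
      linear_combination this / 2
    · rw [← hsum k, Fintype.sum_eq_single (f k), if_pos (hself k)]
      intro b hb
      refine if_neg fun h' => hb ?_
      have h4 : k⁻¹ * b * k⁻¹⁻¹ = a := by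
        rcases h _ (C.conj_mem_carrier k⁻¹ b b.2) (hconj h') with h3 | h3
        · exact h3
        · by_contra hne
          exact hp ⟨h3 ▸ hne, h3 ▸ hconj h'⟩
      simpa using hback (v := 1) (by simpa using h4)
  ext b
  obtain ⟨k, hk⟩ := isConj_iff.1 (ConjClasses.mk_eq_mk_iff_isConj.1
    ((ConjClasses.mem_carrier_iff_mk_eq.1 ha).trans (ConjClasses.mem_carrier_iff_mk_eq.1 b.2).symm))
  have : b = f k := Subtype.ext hk.symm
  rw [this, key, Finsupp.zero_apply]

/-! ### Coordinates and traces in `SL₂` and `PSL₂` -/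

section SpecialLinearGroupTwo

open Matrix MatrixGroups

variable {F : Type*} [Field F]

/-- The matrix `!![p, q; r, s]` of determinant one. -/
def slOf (p q r s : F) (h : p * s - q * r = 1) : SL(2, F) :=
  ⟨!![p, q; r, s], by rw [det_fin_two_of, h]⟩

theorem exists_eq_slOf (A : SL(2, F)) : ∃ p q r s h, A = slOf p q r s h :=
  ⟨_, _, _, _, (det_fin_two (A : Matrix (Fin 2) (Fin 2) F)).symm.trans A.det_coe,
    Matrix.SpecialLinearGroup.ext _ _ fun i j => by fin_cases i <;> fin_cases j <;> rfl⟩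

theorem slOf_inj {p q r s p' q' r' s' : F} {h : p * s - q * r = 1} {h' : p' * s' - q' * r' = 1} :
    slOf p q r s h = slOf p' q' r' s' h' ↔ p = p' ∧ q = q' ∧ r = r' ∧ s = s' := by
  constructor
  · intro H
    have H' (i j) := congrArg (fun A : SL(2, F) => A i j) H
    exact ⟨H' 0 0, H' 0 1, H' 1 0, H' 1 1⟩
  · rintro ⟨rfl, rfl, rfl, rfl⟩
    rfl

theorem slOf_mul {p q r s p' q' r' s' : F} {h : p * s - q * r = 1} {h' : p' * s' - q' * r' = 1} :
    slOf p q r s h * slOf p' q' r' s' h' =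
      slOf (p * p' + q * r') (p * q' + q * s') (r * p' + s * r') (r * q' + s * s')
        (by linear_combination (p' * s' - q' * r') * h + h') :=
  Subtype.ext (mul_fin_two _ _ _ _ _ _ _ _)

theorem neg_slOf {p q r s : F} {h : p * s - q * r = 1} :
    -slOf p q r s h = slOf (-p) (-q) (-r) (-s) (by linear_combination h) :=
  Subtype.ext (show -!![p, q; r, s] = !![-p, -q; -r, -s] by simp)

theorem slOf_one : (1 : SL(2, F)) = slOf 1 0 0 1 (by ring) :=
  Subtype.ext (by simp [slOf, one_fin_two])

/-- The trace of a matrix of determinant one. -/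
def slTrace (A : SL(2, F)) : F := A 0 0 + A 1 1

theorem slTrace_slOf {p q r s : F} {h : p * s - q * r = 1} : slTrace (slOf p q r s h) = p + s := rfl

theorem slTrace_neg (A : SL(2, F)) : slTrace (-A) = -slTrace A := by
  obtain ⟨p, q, r, s, h, rfl⟩ := exists_eq_slOf A
  rw [neg_slOf, slTrace_slOf, slTrace_slOf]
  ring

theorem slTrace_mul_comm (A B : SL(2, F)) : slTrace (A * B) = slTrace (B * A) := by
  obtain ⟨p, q, r, s, h, rfl⟩ := exists_eq_slOf A
  obtain ⟨p', q', r', s', h', rfl⟩ := exists_eq_slOf B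
  simp only [slOf_mul, slTrace_slOf]
  ring

theorem slTrace_conj (A P : SL(2, F)) : slTrace (P * A * P⁻¹) = slTrace A := by
  rw [slTrace_mul_comm, inv_mul_cancel_left]

theorem psl_mk_eq_iff {A B : SL(2, F)} :
    (A : ProjectiveSpecialLinearGroup (Fin 2) F) = B ↔ B = A ∨ B = -A := by
  rw [QuotientGroup.eq, Matrix.SpecialLinearGroup.mem_center_iff, Fintype.card_fin]
  constructor
  · rintro ⟨r, hr, h⟩
    have hB : (B : Matrix (Fin 2) (Fin 2) F) = r • (A : Matrix (Fin 2) (Fin 2) F) := by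
      have : (A : Matrix (Fin 2) (Fin 2) F) * ((A⁻¹ * B : SL(2, F)) :
          Matrix (Fin 2) (Fin 2) F) = B := by
        rw [← Matrix.SpecialLinearGroup.coe_mul, mul_inv_cancel_left]
      rw [← this, ← h, scalar_apply, ← smul_one_eq_diagonal, mul_smul_comm, mul_one]
    rcases eq_or_eq_neg_of_sq_eq_sq r 1 (by rw [hr, one_pow]) with rfl | rfl
    · exact Or.inl (Subtype.ext (by simpa using hB))
    · exact Or.inr (Subtype.ext (by simpa using hB))
  · rintro (rfl | rfl)
    · exact ⟨1, by simp⟩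
    · exact ⟨-1, by simp [← smul_one_eq_diagonal]⟩

theorem psl_isConj_iff {A B : SL(2, F)} :
    IsConj (A : ProjectiveSpecialLinearGroup (Fin 2) F) B ↔
      ∃ P : SL(2, F), P * A * P⁻¹ = B ∨ P * A * P⁻¹ = -B := by
  rw [isConj_iff]
  constructor
  · rintro ⟨k, hk⟩
    obtain ⟨P, rfl⟩ := QuotientGroup.mk_surjective k
    exact ⟨P, psl_mk_eq_iff.1 (show (B : ProjectiveSpecialLinearGroup (Fin 2) F) =
      (P * A * P⁻¹ : SL(2, F)) from hk.symm)⟩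
  · rintro ⟨P, hP⟩
    exact ⟨P, (psl_mk_eq_iff.2 hP).symm⟩

theorem psl_mk_mem_carrier_of_isConj {C : ConjClasses (ProjectiveSpecialLinearGroup (Fin 2) F)}
    {A B : SL(2, F)} (hA : (A : ProjectiveSpecialLinearGroup (Fin 2) F) ∈ C.carrier)
    (h : IsConj A B) : (B : ProjectiveSpecialLinearGroup (Fin 2) F) ∈ C.carrier := by
  obtain ⟨P, rfl⟩ := isConj_iff.1 h
  exact C.conj_mem_carrier P A hA

/-- A form of the odd-cycle criterion in terms of matrices. -/
theorem psl_killingForm_nondegenerate_of_odd [Finite F]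
    {C : ConjClasses (ProjectiveSpecialLinearGroup (Fin 2) F)} (hC : C.IsReal) {a c : SL(2, F)}
    (ha : (a : ProjectiveSpecialLinearGroup (Fin 2) F) ∈ C.carrier)
    (hc : (c : ProjectiveSpecialLinearGroup (Fin 2) F) ∈ C.carrier) (u : SL(2, F))
    (hu : Odd (orderOf u))
    (h : ∀ g : SL(2, F), g * c = c * g ∨ g * c = -(c * g) → slTrace (a * g) = slTrace a →
        (g = 1 ∨ g = -1) ∨ (a * g = u * a * u⁻¹ ∨ a * g = -(u * a * u⁻¹))) :
    C.killingForm.Nondegenerate := by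
  have : Finite (ProjectiveSpecialLinearGroup (Fin 2) F) := inferInstance
  have hu' : Odd (orderOf (u : ProjectiveSpecialLinearGroup (Fin 2) F)) :=
    hu.of_dvd_nat (orderOf_map_dvd (QuotientGroup.mk' _) u)
  refine C.killingForm_nondegenerate_of_odd hC ha hc hu' fun b hb hbc => ?_
  obtain ⟨B, rfl⟩ := QuotientGroup.mk_surjective b
  obtain ⟨P, hP⟩ := psl_isConj_iff.1 (ConjClasses.mk_eq_mk_iff_isConj.1
    ((ConjClasses.mem_carrier_iff_mk_eq.1 ha).trans (ConjClasses.mem_carrier_iff_mk_eq.1 hb).symm))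
  -- Choosing the lift of `b` conjugate to `a` in `SL₂` makes the trace condition exact; only
  -- commutation keeps a sign ambiguity.
  have hB : ((P * a * P⁻¹ : SL(2, F)) : ProjectiveSpecialLinearGroup (Fin 2) F) = B :=
    (psl_mk_eq_iff.2 hP).symm
  change (B : ProjectiveSpecialLinearGroup (Fin 2) F) * c * (B : ProjectiveSpecialLinearGroup (Fin 2) F)⁻¹ =
    a * c * (a : ProjectiveSpecialLinearGroup (Fin 2) F)⁻¹ at hbc
  change (B : ProjectiveSpecialLinearGroup (Fin 2) F) = a ∨
    (B : ProjectiveSpecialLinearGroup (Fin 2) F) = 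
      u * a * (u : ProjectiveSpecialLinearGroup (Fin 2) F)⁻¹
  rw [← hB] at hbc ⊢
  generalize hB' : P * a * P⁻¹ = B' at hbc
  have hcomm : (a⁻¹ * B') * c = c * (a⁻¹ * B') ∨ (a⁻¹ * B') * c = -(c * (a⁻¹ * B')) := by
    refine psl_mk_eq_iff.1 ?_
    simp only [QuotientGroup.mk_mul, QuotientGroup.mk_inv]
    have := congrArg (fun z => (a : ProjectiveSpecialLinearGroup (Fin 2) F)⁻¹ * z * B') hbc
    simpa [mul_assoc] using this.symm
  have := h (a⁻¹ * B') hcomm (by rw [mul_inv_cancel_left, ← hB', slTrace_conj])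
  rw [mul_inv_cancel_left, inv_mul_eq_iff_eq_mul, inv_mul_eq_iff_eq_mul, mul_neg, mul_one] at this
  exact this.imp (fun h5 => (psl_mk_eq_iff.2 h5).symm) fun h5 => (psl_mk_eq_iff.2 h5).symm

/-! ### Representatives of conjugacy classes -/

/-- The matrix `!![0, -1; 1, t]`. -/
def companionSL (t : F) : SL(2, F) := slOf 0 (-1) 1 t (by ring)

/-- The quadratic form in `h` is `det (v, A v)` for `v = (x, y)`. When it equals `1`, the basis `(v,
A v)` is a conjugator in `SL₂`, and Cayley–Hamilton gives the companion matrix. -/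
theorem isConj_companionSL {p q r s : F} (hd : p * s - q * r = 1) (x y : F)
    (h : r * x ^ 2 + (s - p) * (x * y) - q * y ^ 2 = 1) :
    IsConj (slOf p q r s hd) (companionSL (p + s)) := by
  refine isConj_comm.1 (isConj_iff.2 ⟨slOf x (p * x + q * y) y (r * x + s * y) ?_, ?_⟩)
  · linear_combination h
  · rw [mul_inv_eq_iff_eq_mul, companionSL, slOf_mul, slOf_mul, slOf_inj]
    refine ⟨?_, ?_, ?_, ?_⟩
    · ring
    · linear_combination x * hd
    · ring
    · linear_combination y * hd

theorem exists_diagonal_form_eq [Finite F] (h2 : (2 : F) ≠ 0) {α β : F} (hα : α ≠ 0) (hβ : β ≠ 0)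
    (γ : F) : ∃ x y, α * x ^ 2 + β * y ^ 2 = γ := by
  have : Fintype F := Fintype.ofFinite F
  obtain ⟨x, y, h⟩ := FiniteField.exists_root_sum_quadratic (R := F)
    (f := Polynomial.C α * Polynomial.X ^ 2 + Polynomial.C 0 * Polynomial.X + Polynomial.C 0)
    (g := Polynomial.C β * Polynomial.X ^ 2 + Polynomial.C 0 * Polynomial.X + Polynomial.C (-γ))
    (Polynomial.degree_quadratic hα) (Polynomial.degree_quadratic hβ)
    (FiniteField.odd_card_of_char_ne_two fun h => h2 (by
      have := ringChar.Nat.cast_ringChar (R := F)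
      rwa [h] at this))
  refine ⟨x, y, ?_⟩
  simp at h
  linear_combination h

theorem four_ne_zero_of_two_ne_zero (h2 : (2 : F) ≠ 0) : (4 : F) ≠ 0 := by
  have := mul_ne_zero h2 h2
  norm_num at this
  exact this

/-- The form `det (v, A v)` has discriminant `t² - 4` with `t = tr A`, so it is non-degenerate and
represents `1` over a finite field. -/
theorem isConj_companionSL_of_trace_sq_ne_four [Finite F] (h2 : (2 : F) ≠ 0)
    (A : SL(2, F)) (hA : slTrace A ^ 2 ≠ 4) : IsConj A (companionSL (slTrace A)) := by
  obtain ⟨p, q, r, s, hd, rfl⟩ := exists_eq_slOf A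
  rw [slTrace_slOf] at hA ⊢
  by_cases hr : r = 0
  · subst hr
    have hb : s - p ≠ 0 := fun h => hA (by linear_combination (s - p) * h + 4 * hd)
    refine isConj_companionSL hd ((1 + q) / (s - p)) 1 ?_
    field_simp
    ring
  · have h4 := four_ne_zero_of_two_ne_zero h2
    obtain ⟨u, y, h⟩ := exists_diagonal_form_eq h2 hr (div_ne_zero
      (neg_ne_zero.2 (sub_ne_zero.2 hA)) (mul_ne_zero h4 hr)) 1
    refine isConj_companionSL hd (u - (s - p) * y / (2 * r)) y ?_
    rw [← h]
    field_simp
    linear_combination 16 * y ^ 2 * hd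

/-- Every element is a square, so a non-zero diagonal coefficient of `det (v, A v)` suffices; if
both vanish, `A ≠ 1` makes the cross term non-zero. -/
theorem isConj_companionSL_of_two_eq_zero [Finite F] (h2 : (2 : F) = 0)
    (A : SL(2, F)) (hA : A ≠ 1) : IsConj A (companionSL (slTrace A)) := by
  obtain ⟨p, q, r, s, hd, rfl⟩ := exists_eq_slOf A
  rw [slTrace_slOf]
  have hsq (z : F) : ∃ w, z = w * w := FiniteField.isSquare_of_char_two
    (CharP.ringChar_of_prime_eq_zero Nat.prime_two (by exact_mod_cast h2)) z
  by_cases hr : r = 0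
  · subst hr
    by_cases hq : q = 0
    · subst hq
      have hb : s - p ≠ 0 := by
        intro hb
        obtain rfl : s = p := sub_eq_zero.1 hb
        have h1 : (s - 1) ^ 2 = 0 := by linear_combination hd + (1 - s) * h2
        obtain rfl : s = 1 := sub_eq_zero.1 (pow_eq_zero_iff two_ne_zero |>.1 h1)
        exact hA slOf_one.symm
      refine isConj_companionSL hd (1 / (s - p)) 1 ?_
      field_simp
      ring
    · obtain ⟨w, hw⟩ := hsq (-q)
      have hw0 : w ≠ 0 := by rintro rfl; simp at hw; exact hq hw
      refine isConj_companionSL hd 0 (1 / w) ?_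
      field_simp
      linear_combination hw
  · obtain ⟨w, rfl⟩ := hsq r
    have hw0 : w ≠ 0 := by rintro rfl; simp at hr
    refine isConj_companionSL hd (1 / w) 0 ?_
    field_simp
    ring

/-- A unipotent matrix is conjugate to a lower triangular one. -/
theorem exists_isConj_lower_of_slTrace_eq_two (A : SL(2, F)) (hA : A ≠ 1) (ht : slTrace A = 2) :
    ∃ b : F, b ≠ 0 ∧ IsConj A (slOf 1 0 b 1 (by ring)) := by
  obtain ⟨p, q, r, s, hd, rfl⟩ := exists_eq_slOf A
  obtain rfl : s = 2 - p := by rw [slTrace_slOf] at ht; linear_combination ht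
  by_cases hr : r = 0
  · subst hr
    have h1 : (p - 1) ^ 2 = 0 := by linear_combination -hd
    obtain rfl : p = 1 := sub_eq_zero.1 (pow_eq_zero_iff two_ne_zero |>.1 h1)
    refine ⟨-q, ?_, isConj_comm.1 (isConj_iff.2 ⟨slOf 0 (-1) 1 0 (by ring), ?_⟩)⟩
    · rw [neg_ne_zero]
      rintro rfl
      exact hA (by rw [slOf_one, slOf_inj]; norm_num)
    · rw [mul_inv_eq_iff_eq_mul, slOf_mul, slOf_mul, slOf_inj]
      refine ⟨?_, ?_, ?_, ?_⟩ <;> ring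
  · refine ⟨r, hr, isConj_comm.1 (isConj_iff.2 ⟨slOf 1 ((p - 1) / r) 0 1 (by ring), ?_⟩)⟩
    rw [mul_inv_eq_iff_eq_mul, slOf_mul, slOf_mul, slOf_inj]
    refine ⟨?_, ?_, ?_, ?_⟩ <;> field_simp
    · ring
    · linear_combination hd
    · ring
    · ring

/-! ### Centralizers -/

theorem slOf_eq_one_or_neg_one {p s : F} {h : p * s - 0 * 0 = 1} (hps : p = s) :
    slOf p 0 0 s h = 1 ∨ slOf p 0 0 s h = -1 := by
  subst hps
  rcases eq_or_eq_neg_of_sq_eq_sq p 1 (by linear_combination h) with rfl | rfl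
  · exact Or.inl slOf_one.symm
  · exact Or.inr (by rw [slOf_one, neg_slOf, slOf_inj]; simp)

/-- The matrices commuting with a non-scalar matrix `c` are the combinations of `1` and `c`. -/
theorem exists_of_slOf_commute {p q r s x y z w : F} {h : p * s - q * r = 1}
    {h' : x * w - y * z = 1} (hc : z ≠ 0 ∨ y ≠ 0 ∨ x ≠ w)
    (hg : slOf p q r s h * slOf x y z w h' = slOf x y z w h' * slOf p q r s h) :
    ∃ k, p = s + k * (x - w) ∧ q = k * y ∧ r = k * z := by
  simp only [slOf_mul, slOf_inj] at hg
  obtain ⟨e1, e2, e3, -⟩ := hg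
  by_cases hz : z = 0
  · subst hz
    by_cases hy : y = 0
    · subst hy
      have hxw : x - w ≠ 0 := sub_ne_zero.2 (by simpa using hc)
      refine ⟨(p - s) / (x - w), ?_, ?_, ?_⟩
      · field_simp
        ring
      · rw [mul_zero]
        exact (mul_eq_zero.1 (show (x - w) * q = 0 by linear_combination -e2)).resolve_left hxw
      · rw [mul_zero]
        exact (mul_eq_zero.1 (show (x - w) * r = 0 by linear_combination e3)).resolve_left hxw
    · refine ⟨q / y, ?_, ?_, ?_⟩ <;> field_simp
      · linear_combination e2
      · linear_combination -e1
  · refine ⟨r / z, ?_, ?_, ?_⟩ <;> field_simp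
    · linear_combination -e3
    · linear_combination e1

/-- Up to sign, a matrix of determinant one commuting with an element of non-zero trace commutes
with it on the nose. -/
theorem commute_of_slTrace_ne_zero {g c : SL(2, F)} (hc : slTrace c ≠ 0) (h2 : (2 : F) ≠ 0)
    (h : g * c = c * g ∨ g * c = -(c * g)) : g * c = c * g := by
  refine h.resolve_right fun h => hc ?_
  have h1 : g * c * g⁻¹ = -c := by rw [h, neg_mul, mul_inv_cancel_right]
  have h3 := congrArg slTrace h1
  rw [slTrace_conj, slTrace_neg] at h3
  exact (mul_eq_zero.1 (show 2 * slTrace c = 0 by linear_combination h3)).resolve_left h2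

theorem psl_killingForm_nondegenerate_of_unique [Finite F]
    {C : ConjClasses (ProjectiveSpecialLinearGroup (Fin 2) F)} (hC : C.IsReal) {a c : SL(2, F)}
    (ha : (a : ProjectiveSpecialLinearGroup (Fin 2) F) ∈ C.carrier)
    (hc : (c : ProjectiveSpecialLinearGroup (Fin 2) F) ∈ C.carrier)
    (h : ∀ g : SL(2, F), g * c = c * g ∨ g * c = -(c * g) → slTrace (a * g) = slTrace a →
        (g = 1 ∨ g = -1)) :
    C.killingForm.Nondegenerate :=
  psl_killingForm_nondegenerate_of_odd hC ha hc 1 (by simp) fun g h1 h2 => Or.inl (h g h1 h2)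

/-! ### Semisimple classes in odd characteristic -/

/-- Semisimple classes of non-zero trace in odd characteristic. -/
theorem psl_killingForm_nondegenerate_of_slTrace_sq_ne_four [Finite F] (h2 : (2 : F) ≠ 0)
    {C : ConjClasses (ProjectiveSpecialLinearGroup (Fin 2) F)} (hC : C.IsReal) {A : SL(2, F)}
    (hA : (A : ProjectiveSpecialLinearGroup (Fin 2) F) ∈ C.carrier)
    (ht : slTrace A ≠ 0) (ht4 : slTrace A ^ 2 ≠ 4) : C.killingForm.Nondegenerate := by
  have h4 := four_ne_zero_of_two_ne_zero h2
  have hconj := isConj_companionSL_of_trace_sq_ne_four h2 A ht4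
  generalize htt : slTrace A = t at *
  -- With `a` the companion matrix, `c = t/2 + c₀` is sought with `tr c₀ = tr (a c₀) = 0`. The trace
  -- condition then forces `g = 1 + k c₀`, and `det g = 1 - k² (t² - 4)/4` leaves `k = 0`.
  -- Completing the square in `det c₀ = 1 - t²/4` gives this diagonal equation.
  obtain ⟨w, z, hwz⟩ := exists_diagonal_form_eq h2 one_ne_zero
    (neg_ne_zero.2 (div_ne_zero (sub_ne_zero.2 ht4) h4)) ((t ^ 2 - 4) / 4)
  obtain ⟨u, rfl⟩ : ∃ u, w = u + t * z / 2 := ⟨w - t * z / 2, by ring⟩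
  have huz : u ^ 2 + t * u * z + z ^ 2 = (t ^ 2 - 4) / 4 := by
    rw [← hwz]
    field_simp
    ring
  have hdet : (t / 2 + u) * (t / 2 - u) - (z + t * u) * z = 1 := by
    field_simp at huz ⊢
    linear_combination -huz
  have hc := isConj_companionSL_of_trace_sq_ne_four h2 (slOf (t / 2 + u) (z + t * u) z (t / 2 - u) hdet)
  have hctr : t / 2 + u + (t / 2 - u) = t := by field_simp; ring
  rw [slTrace_slOf, hctr] at hc
  have ha' := psl_mk_mem_carrier_of_isConj hA hconj
  refine psl_killingForm_nondegenerate_of_unique hC ha'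
    (psl_mk_mem_carrier_of_isConj ha' (isConj_comm.1 (hc ht4))) fun g hg htr => ?_
  replace hg := commute_of_slTrace_ne_zero (by rwa [slTrace_slOf, hctr]) h2 hg
  obtain ⟨p, q, r, s, hd, rfl⟩ := exists_eq_slOf g
  rw [companionSL] at htr
  obtain ⟨k, rfl, rfl, rfl⟩ := exists_of_slOf_commute (by
    by_contra! hcon
    obtain ⟨h5, h6, h7⟩ := hcon
    subst h5
    have h8 : u = 0 := (mul_eq_zero.1 (show 2 * u = 0 by linear_combination h7)).resolve_left h2
    subst h8
    exact div_ne_zero (sub_ne_zero.2 ht4) h4 (by rw [← huz]; ring)) hg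
  simp only [slOf_mul, slTrace_slOf] at htr
  have hs : s = 1 - k * u := mul_left_cancel₀ ht (by linear_combination htr)
  subst hs
  have hk : k ^ 2 * ((t ^ 2 - 4) / 4) = 0 := by
    rw [← huz]
    linear_combination -hd
  have hk0 : k = 0 := pow_eq_zero_iff two_ne_zero |>.1
    ((mul_eq_zero.1 hk).resolve_right (div_ne_zero (sub_ne_zero.2 ht4) h4))
  subst hk0
  simp only [zero_mul]
  exact slOf_eq_one_or_neg_one (by ring)

/-- Classes of involutions in odd characteristic. -/
theorem psl_killingForm_nondegenerate_of_slTrace_eq_zero [Finite F] (h2 : (2 : F) ≠ 0)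
    (h3 : Nat.card F ≠ 3)
    {C : ConjClasses (ProjectiveSpecialLinearGroup (Fin 2) F)} (hC : C.IsReal) {A : SL(2, F)}
    (hA : (A : ProjectiveSpecialLinearGroup (Fin 2) F) ∈ C.carrier)
    (ht : slTrace A = 0) : C.killingForm.Nondegenerate := by
  have h4 := four_ne_zero_of_two_ne_zero h2
  have hconj (B : SL(2, F)) (hB : slTrace B = 0) : IsConj B (companionSL 0) := by
    have := isConj_companionSL_of_trace_sq_ne_four h2 B (by rw [hB]; simpa using h4.symm)
    rwa [hB] at this
  have ha := psl_mk_mem_carrier_of_isConj hA (hconj A ht)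
  by_cases hi : ∃ i : F, i ^ 2 = -1
  · obtain ⟨i, hi⟩ := hi
    -- The entry `2` in `c` is what excludes anticommuting `g`: it forces `q = r = -i p` and `s =
    -- -p`, hence `det g = 0`.
    refine psl_killingForm_nondegenerate_of_unique hC ha (psl_mk_mem_carrier_of_isConj ha
      (isConj_comm.1 (hconj (slOf i 0 2 (-i) (by linear_combination -hi))
        (by rw [slTrace_slOf]; ring)))) fun g hg htr => ?_
    obtain ⟨p, q, r, s, hd, rfl⟩ := exists_eq_slOf g
    rw [companionSL] at htr
    simp only [slOf_mul, slTrace_slOf] at htr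
    obtain rfl : q = r := by linear_combination htr
    rcases hg with hg | hg
    · obtain ⟨k, rfl, hq, hr⟩ := exists_of_slOf_commute (Or.inl h2) hg
      obtain rfl : q = 0 := by rw [hq, mul_zero]
      obtain rfl : k = 0 := (mul_eq_zero.1 hr.symm).resolve_right h2
      exact slOf_eq_one_or_neg_one (by ring)
    · simp only [slOf_mul, neg_slOf, slOf_inj] at hg
      obtain ⟨e1, -, -, e4⟩ := hg
      have h5 : q = -(i * p) := mul_left_cancel₀ h2 (by linear_combination e1)
      have h6 : s = -p := mul_left_cancel₀ h2 (by
        linear_combination i * e4 - i * e1 + 2 * (s + p) * hi)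
      exfalso
      refine one_ne_zero (α := F) ?_
      rw [← hd, h5, h6]
      linear_combination -p ^ 2 * hi
  · obtain ⟨y, hy0, hy1⟩ : ∃ y : F, y ≠ 0 ∧ y ^ 2 ≠ 1 := by
      by_contra! hall
      apply h3
      have : (Set.univ : Set F) = {0, 1, -1} := by
        ext y
        simp only [Set.mem_univ, Set.mem_insert_iff, Set.mem_singleton_iff, true_iff]
        by_cases hy : y = 0
        · exact Or.inl hy
        · exact Or.inr (eq_or_eq_neg_of_sq_eq_sq y 1 (by rw [hall y hy, one_pow]))
      rw [← Set.ncard_univ, this, Set.ncard_eq_three]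
      refine ⟨0, 1, -1, zero_ne_one, by simp, fun h => h2 (by linear_combination h), rfl⟩
    -- Commuting `g` are scalar because `y² ≠ -1`. Anticommuting `g` have `q = 0` because `y² ≠ 1`,
    -- and then `-p² = 1` is impossible.
    refine psl_killingForm_nondegenerate_of_unique hC ha (psl_mk_mem_carrier_of_isConj ha
      (isConj_comm.1 (hconj (slOf 0 y (-y⁻¹) 0 (by field_simp; ring))
        (by rw [slTrace_slOf]; ring)))) fun g hg htr => ?_
    obtain ⟨p, q, r, s, hd, rfl⟩ := exists_eq_slOf g
    rw [companionSL] at htr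
    simp only [slOf_mul, slTrace_slOf] at htr
    obtain rfl : q = r := by linear_combination htr
    rcases hg with hg | hg
    · obtain ⟨k, rfl, hq, hr⟩ := exists_of_slOf_commute (Or.inr (Or.inl hy0)) hg
      have hk : k * (y ^ 2 + 1) = 0 := by
        rw [hq] at hr
        field_simp at hr
        linear_combination hr
      obtain rfl : k = 0 :=
        (mul_eq_zero.1 hk).resolve_right fun h => hi ⟨y, eq_neg_of_add_eq_zero_left h⟩
      obtain rfl : q = 0 := by rw [hq, zero_mul]
      exact slOf_eq_one_or_neg_one (by ring)
    · simp only [slOf_mul, neg_slOf, slOf_inj] at hg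
      obtain ⟨e1, e2, -, -⟩ := hg
      have hq : q * (y ^ 2 - 1) = 0 := by
        field_simp at e1
        linear_combination e1
      obtain rfl : q = 0 := (mul_eq_zero.1 hq).resolve_right (sub_ne_zero.2 hy1)
      obtain rfl : s = -p := mul_left_cancel₀ hy0 (by linear_combination e2)
      exact absurd ⟨p, by linear_combination -hd⟩ hi

/-! ### Unipotent classes -/

/-- Trace `2` means `u = 1 + N` with `N² = 0`, so `u ^ n = 1 + n N`; in characteristic `p` the order
divides `p`. -/
theorem slOf_unipotent_pow {p q r : F} {h : p * (2 - p) - q * r = 1} (n : ℕ) :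
    ∃ h', slOf p q r (2 - p) h ^ n =
      slOf (1 + n * (p - 1)) (n * q) (n * r) (1 + n * (1 - p)) h' := by
  induction n with
  | zero => exact ⟨by simp, by rw [pow_zero, slOf_one, slOf_inj]; simp⟩
  | succ n ih =>
    obtain ⟨h', ih⟩ := ih
    refine ⟨by push_cast; linear_combination ((n : F) + 1) ^ 2 * h, ?_⟩
    rw [pow_succ, ih, slOf_mul, slOf_inj]
    push_cast
    refine ⟨?_, ?_, ?_, ?_⟩
    · linear_combination -(n : F) * h
    · ring
    · ring
    · linear_combination -(n : F) * h

theorem odd_orderOf_of_slTrace_eq_two [Finite F] (h2 : (2 : F) ≠ 0) {u : SL(2, F)}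
    (hu : slTrace u = 2) : Odd (orderOf u) := by
  obtain ⟨p, q, r, s, hd, rfl⟩ := exists_eq_slOf u
  obtain rfl : s = 2 - p := by rw [slTrace_slOf] at hu; linear_combination hu
  have hprime : (ringChar F).Prime := CharP.char_is_prime F _
  have hodd : Odd (ringChar F) := hprime.odd_of_ne_two fun h => h2 (by
    have := ringChar.Nat.cast_ringChar (R := F)
    rwa [h] at this)
  refine hodd.of_dvd_nat (orderOf_dvd_of_pow_eq_one ?_)
  obtain ⟨h', h⟩ := slOf_unipotent_pow (h := hd) (ringChar F)
  rw [h, slOf_one, slOf_inj]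
  simp

theorem neg_eq_self_of_two_eq_zero (h2 : (2 : F) = 0) (A : SL(2, F)) : -A = A := by
  obtain ⟨p, q, r, s, hd, rfl⟩ := exists_eq_slOf A
  rw [neg_slOf, slOf_inj]
  refine ⟨?_, ?_, ?_, ?_⟩
  · linear_combination -p * h2
  · linear_combination -q * h2
  · linear_combination -r * h2
  · linear_combination -s * h2

theorem slOf_lower_isConj_upper (b : F) :
    IsConj (slOf 1 0 b 1 (by ring)) (slOf 1 (-b) 0 1 (by ring)) := by
  refine isConj_iff.2 ⟨slOf 0 (-1) 1 0 (by ring), ?_⟩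
  rw [mul_inv_eq_iff_eq_mul, slOf_mul, slOf_mul, slOf_inj]
  refine ⟨?_, ?_, ?_, ?_⟩ <;> ring

/-- If a non-trivial unipotent class is real in odd characteristic, then `-1` is a square. -/
theorem exists_sq_eq_neg_one_of_isReal (h2 : (2 : F) ≠ 0)
    {C : ConjClasses (ProjectiveSpecialLinearGroup (Fin 2) F)} (hC : C.IsReal) {b : F} (hb : b ≠ 0)
    (ha : (slOf 1 0 b 1 (by ring) : ProjectiveSpecialLinearGroup (Fin 2) F) ∈ C.carrier) :
    ∃ i : F, i ^ 2 = -1 := by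
  have hinv : (slOf 1 0 b 1 (by ring))⁻¹ = slOf 1 0 (-b) 1 (by ring) := by
    rw [inv_eq_iff_mul_eq_one, slOf_mul, slOf_one, slOf_inj]
    refine ⟨?_, ?_, ?_, ?_⟩ <;> ring
  have h1 := hC _ ha
  rw [← QuotientGroup.mk_inv, hinv] at h1
  obtain ⟨k, hk⟩ := psl_isConj_iff.1 (ConjClasses.mk_eq_mk_iff_isConj.1
    ((ConjClasses.mem_carrier_iff_mk_eq.1 ha).trans (ConjClasses.mem_carrier_iff_mk_eq.1 h1).symm))
  rcases hk with hk | hk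
  · rw [mul_inv_eq_iff_eq_mul] at hk
    obtain ⟨x, y, z, w, hd, rfl⟩ := exists_eq_slOf k
    simp only [slOf_mul, slOf_inj] at hk
    obtain ⟨e1, -, e3, -⟩ := hk
    obtain rfl : y = 0 := (mul_eq_zero.1 (show b * y = 0 by linear_combination e1)).resolve_left hb
    obtain rfl : w = -x := mul_left_cancel₀ hb (by linear_combination e3)
    exact ⟨x, by linear_combination -hd⟩
  · have := congrArg slTrace hk
    rw [slTrace_conj, slTrace_neg, slTrace_slOf, slTrace_slOf] at this
    exact absurd (by linear_combination this) (four_ne_zero_of_two_ne_zero h2)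

/-- Real unipotent classes. -/
theorem psl_killingForm_nondegenerate_of_slTrace_eq_two [Finite F]
    {C : ConjClasses (ProjectiveSpecialLinearGroup (Fin 2) F)} (hC : C.IsReal) {A : SL(2, F)}
    (hA : (A : ProjectiveSpecialLinearGroup (Fin 2) F) ∈ C.carrier)
    (ht : slTrace A = 2) (hA1 : A ≠ 1) : C.killingForm.Nondegenerate := by
  obtain ⟨b, hb, hconj⟩ := exists_isConj_lower_of_slTrace_eq_two A hA1 ht
  have ha := psl_mk_mem_carrier_of_isConj hA hconj
  have hc := psl_mk_mem_carrier_of_isConj ha (slOf_lower_isConj_upper b)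
  have key (g : SL(2, F)) (hg : g * slOf 1 (-b) 0 1 (by ring) = slOf 1 (-b) 0 1 (by ring) * g)
      (htr : slTrace (slOf 1 0 b 1 (by ring) * g) = slTrace (slOf 1 0 b 1 (by ring))) :
      g = 1 ∨ ∃ q h, g = slOf (-1) q 0 (-1) h ∧ b * q = 4 := by
    obtain ⟨p, q, r, s, hd, rfl⟩ := exists_eq_slOf g
    obtain ⟨k, hp, -, hr⟩ := exists_of_slOf_commute (Or.inr (Or.inl (neg_ne_zero.2 hb))) hg
    obtain rfl : r = 0 := by rw [hr, mul_zero]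
    obtain rfl : p = s := by rw [hp]; ring
    simp only [slOf_mul, slTrace_slOf] at htr
    rcases eq_or_eq_neg_of_sq_eq_sq p 1 (by linear_combination hd) with rfl | rfl
    · obtain rfl : q = 0 :=
        (mul_eq_zero.1 (show b * q = 0 by linear_combination htr)).resolve_left hb
      exact Or.inl slOf_one.symm
    · exact Or.inr ⟨q, hd, rfl, by linear_combination htr⟩
  by_cases h2 : (2 : F) = 0
  · refine psl_killingForm_nondegenerate_of_unique hC ha hc fun g hg htr => ?_
    rw [neg_eq_self_of_two_eq_zero h2, or_self] at hg
    rcases key g hg htr with rfl | ⟨q, h, rfl, hq⟩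
    · exact Or.inl rfl
    · obtain rfl : q = 0 :=
        (mul_eq_zero.1 (show b * q = 0 by linear_combination hq + 2 * h2)).resolve_left hb
      exact slOf_eq_one_or_neg_one rfl
  · obtain ⟨i, hi⟩ := exists_sq_eq_neg_one_of_isReal h2 hC hb ha
    -- The second column of `u` is `i` times the vector `(2/b, 1)` fixed by `a g`, where `g` is the
    -- second solution; the factor has to square to `-1`, which is where reality enters. The first
    -- column is fitted to determinant `1` and trace `2`.
    refine psl_killingForm_nondegenerate_of_odd hC ha hc
      (slOf (2 - i) (2 * i / b) b i (by field_simp; linear_combination -hi))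
      (odd_orderOf_of_slTrace_eq_two h2 (by rw [slTrace_slOf]; ring)) fun g hg htr => ?_
    replace hg := commute_of_slTrace_ne_zero (by rw [slTrace_slOf]; norm_num; exact h2) h2 hg
    rcases key g hg htr with rfl | ⟨q, h, rfl, hq⟩
    · exact Or.inl (Or.inl rfl)
    · refine Or.inr (Or.inl ?_)
      obtain rfl : q = 4 / b := by field_simp; linear_combination hq
      rw [eq_mul_inv_iff_mul_eq, slOf_mul, slOf_mul, slOf_mul, slOf_inj]
      refine ⟨?_, ?_, ?_, ?_⟩ <;> field_simp <;> ring

/-! ### Semisimple classes in characteristic two -/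

theorem slOf_mul_self_of_slTrace_eq_zero {g : SL(2, F)} (hg : slTrace g = 0) : g * g = -1 := by
  obtain ⟨p, q, r, s, hd, rfl⟩ := exists_eq_slOf g
  obtain rfl : s = -p := by rw [slTrace_slOf] at hg; linear_combination hg
  rw [slOf_mul, slOf_one, neg_slOf, slOf_inj]
  refine ⟨?_, ?_, ?_, ?_⟩
  · linear_combination -hd
  · ring
  · ring
  · linear_combination -hd

/-- An even order would yield an involution among the powers of `g`. It has trace zero and is a
combination of `1` and `g`; since `tr g ≠ 0`, it is scalar, hence `1`. -/
theorem odd_orderOf_of_slTrace_ne_zero [Finite F] (h2 : (2 : F) = 0) {g : SL(2, F)}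
    (hg : slTrace g ≠ 0) : Odd (orderOf g) := by
  by_contra hodd
  obtain ⟨m, hm⟩ := Nat.not_odd_iff_even.1 hodd
  have hpos : 0 < orderOf g := orderOf_pos g
  have hz1 : g ^ m ≠ 1 := pow_ne_one_of_lt_orderOf (by omega) (by omega)
  have hz2 : g ^ m * g ^ m = 1 := by rw [← pow_add, ← hm, pow_orderOf_eq_one]
  have hcomm : g ^ m * g = g * g ^ m := (Commute.refl g).pow_left m
  obtain ⟨p, q, r, s, hd, hz⟩ := exists_eq_slOf (g ^ m)
  obtain ⟨x, y, z, w, hd', rfl⟩ := exists_eq_slOf g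
  rw [slTrace_slOf] at hg
  have hxw : x - w ≠ 0 := fun h => hg (by linear_combination h + w * h2)
  rw [hz] at hz1 hz2 hcomm
  obtain ⟨k, hp, hq, hr⟩ := exists_of_slOf_commute (Or.inr (Or.inr (sub_ne_zero.1 hxw))) hcomm
  rw [slOf_mul, slOf_one, slOf_inj] at hz2
  obtain ⟨e1, e2, e3, e4⟩ := hz2
  have h1 : p * (p + s) = 0 := by linear_combination e1 + hd + h2
  have hps : p + s = 0 := by
    by_contra hne
    have hp0 : p = 0 := (mul_eq_zero.1 h1).resolve_right hne
    have hq0 : q = 0 := (mul_eq_zero.1 (show q * (p + s) = 0 by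
      linear_combination e2)).resolve_right hne
    rw [hp0, hq0] at hd
    simp at hd
  have hk : k = 0 := (mul_eq_zero.1 (show k * (x - w) = 0 by
    linear_combination hps - hp - s * h2)).resolve_right hxw
  subst hk
  rw [zero_mul] at hq hr
  subst hq hr
  refine hz1 ((slOf_eq_one_or_neg_one (by rw [hp]; ring)).elim id fun h => ?_)
  rw [h, neg_eq_self_of_two_eq_zero h2]

/-- Semisimple classes in characteristic two. -/
theorem psl_killingForm_nondegenerate_of_slTrace_ne_zero [Finite F] (h2 : (2 : F) = 0)
    (hF : Nat.card F ≠ 2)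
    {C : ConjClasses (ProjectiveSpecialLinearGroup (Fin 2) F)} (hC : C.IsReal) {A : SL(2, F)}
    (hA : (A : ProjectiveSpecialLinearGroup (Fin 2) F) ∈ C.carrier)
    (ht : slTrace A ≠ 0) : C.killingForm.Nondegenerate := by
  have hconj (B : SL(2, F)) (hB : slTrace B = slTrace A) : IsConj B (companionSL (slTrace A)) := by
    have := isConj_companionSL_of_two_eq_zero h2 B fun h => by
      rw [h, slOf_one, slTrace_slOf] at hB
      exact ht (by rw [← hB]; linear_combination h2)
    rwa [hB] at this
  have ha := psl_mk_mem_carrier_of_isConj hA (hconj A rfl)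
  generalize slTrace A = t at *
  obtain ⟨y, hy0, hy1⟩ : ∃ y : F, y ≠ 0 ∧ y ≠ 1 := by
    by_contra! hall
    apply hF
    have : (Set.univ : Set F) = {0, 1} := by
      ext y
      simp only [Set.mem_univ, Set.mem_insert_iff, Set.mem_singleton_iff, true_iff]
      by_cases hy : y = 0
      · exact Or.inl hy
      · exact Or.inr (hall y hy)
    rw [← Set.ncard_univ, this, Set.ncard_pair zero_ne_one]
  have hdc : 0 * t - -y⁻¹ * y = 1 := by field_simp; ring
  have hc := psl_mk_mem_carrier_of_isConj ha (isConj_comm.1 (hconj (slOf 0 (-y⁻¹) y t hdc)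
    (by rw [slTrace_slOf]; ring)))
  -- Once the trace condition is solved, `det g = 1` is a quadratic in `k` with root `0`, so at most
  -- one non-trivial `g` survives.
  have key (g : SL(2, F)) (hg : g * slOf 0 (-y⁻¹) y t hdc = slOf 0 (-y⁻¹) y t hdc * g)
      (htr : slTrace (companionSL t * g) = slTrace (companionSL t)) :
      ∃ k h, g = slOf (1 + k * ((y + y⁻¹) / t) - k * t) (-(k * y⁻¹)) (k * y)
          (1 + k * ((y + y⁻¹) / t)) h ∧
        k * (k * (((y + y⁻¹) / t) ^ 2 - (y + y⁻¹) + 1) - t) = 0 := by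
    obtain ⟨p, q, r, s, hd, rfl⟩ := exists_eq_slOf g
    obtain ⟨k, rfl, rfl, rfl⟩ := exists_of_slOf_commute (Or.inl hy0) hg
    simp only [companionSL, slOf_mul, slTrace_slOf] at htr
    have hyy : y * y⁻¹ = 1 := mul_inv_cancel₀ hy0
    have hm : t * ((y + y⁻¹) / t) = y + y⁻¹ := mul_div_cancel₀ _ ht
    generalize y⁻¹ = y' at *
    obtain rfl : s = 1 + k * ((y + y') / t) := by
      field_simp
      linear_combination htr
    refine ⟨k, by linear_combination hd, by rw [slOf_inj]; refine ⟨?_, ?_, ?_, ?_⟩ <;> ring, ?_⟩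
    linear_combination hd - k * ((y + y') / t) * h2 + k ^ 2 * hm - k ^ 2 * hyy
  by_cases hex : ∃ g : SL(2, F), g ≠ 1 ∧
      g * slOf 0 (-y⁻¹) y t hdc = slOf 0 (-y⁻¹) y t hdc * g ∧
      slTrace (companionSL t * g) = slTrace (companionSL t)
  · obtain ⟨g₀, hg1, hg2, hg3⟩ := hex
    obtain ⟨v, hv⟩ := isConj_iff.1 (isConj_comm.1 (hconj (companionSL t * g₀)
      (by rw [hg3, companionSL, slTrace_slOf]; ring)))
    obtain ⟨k₀, hd₀, rfl, hk₀⟩ := key _ hg2 hg3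
    have hk₀0 : k₀ ≠ 0 := fun h => hg1 (by
      subst h
      rw [slOf_one, slOf_inj]
      simp)
    have hE := (mul_eq_zero.1 hk₀).resolve_left hk₀0
    -- Both `v` and `v a` conjugate `a` to `a g₀`, and non-zero trace gives odd order. If both
    -- traces vanished, `v` and `v a` would square to `1`, so `a g₀ = v a v⁻¹ = a⁻¹`, which forces
    -- `y = y⁻¹` and so `y = 1`.
    obtain ⟨u, hu, hua⟩ : ∃ u : SL(2, F), Odd (orderOf u) ∧
        u * companionSL t * u⁻¹ = v * companionSL t * v⁻¹ := by
      by_cases hv0 : slTrace v = 0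
      · refine ⟨v * companionSL t, odd_orderOf_of_slTrace_ne_zero h2 fun hva0 => ?_, by group⟩
        have h5 := slOf_mul_self_of_slTrace_eq_zero hv0
        have h6 := slOf_mul_self_of_slTrace_eq_zero hva0
        rw [neg_eq_self_of_two_eq_zero h2] at h5 h6
        rw [inv_eq_of_mul_eq_one_left h5] at hv
        have h7 : companionSL t * (companionSL t *
            slOf (1 + k₀ * ((y + y⁻¹) / t) - k₀ * t) (-(k₀ * y⁻¹)) (k₀ * y)
              (1 + k₀ * ((y + y⁻¹) / t)) hd₀) = 1 := by
          rw [← hv, mul_eq_one_comm]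
          simpa only [mul_assoc] using h6
        simp only [companionSL, slOf_mul, slOf_one, slOf_inj] at h7
        obtain ⟨e1, e2, e3, e4⟩ := h7
        have hr : k₀ * y = -t := by linear_combination -(t * e1) - e3
        have hq : k₀ * y⁻¹ = -t := by linear_combination (1 - t ^ 2) * e2 - t * e4
        have hy : y = y⁻¹ := mul_left_cancel₀ hk₀0 (hr.trans hq.symm)
        have hyy : y * y⁻¹ = 1 := mul_inv_cancel₀ hy0
        rw [← hy] at hyy
        refine hy1 (sub_eq_zero.1 (pow_eq_zero_iff two_ne_zero |>.1 ?_))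
        linear_combination hyy + (1 - y) * h2
      · exact ⟨v, odd_orderOf_of_slTrace_ne_zero h2 hv0, rfl⟩
    refine psl_killingForm_nondegenerate_of_odd hC ha hc u hu fun g hg htr => ?_
    rw [neg_eq_self_of_two_eq_zero h2, or_self] at hg
    rw [hua, hv]
    obtain ⟨k, hd, rfl, hk⟩ := key g hg htr
    rcases mul_eq_zero.1 hk with rfl | hk
    · refine Or.inl (Or.inl ?_)
      rw [slOf_one, slOf_inj]
      simp
    · refine Or.inr (Or.inl ?_)
      obtain rfl : k = k₀ := by
        have hne : ((y + y⁻¹) / t) ^ 2 - (y + y⁻¹) + 1 ≠ 0 := by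
          intro h
          rw [h] at hk
          exact ht (by linear_combination -hk)
        exact mul_right_cancel₀ hne (by linear_combination hk - hE)
      rfl
  · push Not at hex
    refine psl_killingForm_nondegenerate_of_unique hC ha hc fun g hg htr => ?_
    rw [neg_eq_self_of_two_eq_zero h2, or_self] at hg
    by_contra hne
    exact hex g (fun h => hne (Or.inl h)) hg htr

/-! ### The exceptional classes and the final case distinction -/

theorem slTrace_eq_or_eq_neg_of_mem_carrier
    {C : ConjClasses (ProjectiveSpecialLinearGroup (Fin 2) F)} {A B : SL(2, F)}
    (hA : (A : ProjectiveSpecialLinearGroup (Fin 2) F) ∈ C.carrier)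
    (hB : (B : ProjectiveSpecialLinearGroup (Fin 2) F) ∈ C.carrier) :
    slTrace B = slTrace A ∨ slTrace B = -slTrace A := by
  obtain ⟨P, hP⟩ := psl_isConj_iff.1 (ConjClasses.mk_eq_mk_iff_isConj.1
    ((ConjClasses.mem_carrier_iff_mk_eq.1 hA).trans (ConjClasses.mem_carrier_iff_mk_eq.1 hB).symm))
  rw [← slTrace_conj A P]
  rcases hP with hP | hP
  · exact Or.inl (by rw [hP])
  · exact Or.inr (by rw [hP, slTrace_neg, neg_neg])

theorem psl_orderOf_eq_two {B : SL(2, F)} (h2 : (2 : F) ≠ 0) (hB : slTrace B = 0) :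
    orderOf (B : ProjectiveSpecialLinearGroup (Fin 2) F) = 2 := by
  have h1 : slTrace (1 : SL(2, F)) = 2 := by rw [slOf_one, slTrace_slOf]; norm_num
  refine orderOf_eq_prime ?_ fun h => h2 ?_
  · rw [pow_two, ← QuotientGroup.mk_mul, slOf_mul_self_of_slTrace_eq_zero hB]
    exact (psl_mk_eq_iff (A := 1)).2 (Or.inr rfl) |>.symm
  · rcases (psl_mk_eq_iff (A := 1)).1 h.symm with rfl | rfl
    · rw [← h1, hB]
    · rw [slTrace_neg, h1] at hB
      linear_combination -hB

/-- Trace `1` gives `B² - B + 1 = 0`, hence `B³ = -1`. The condition `3 ≠ 0` excludes `B = -1`,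
whose trace is `-2`. -/
theorem psl_orderOf_eq_three {B : SL(2, F)} (h3 : (3 : F) ≠ 0)
    (hB : slTrace B = 1 ∨ slTrace B = -1) :
    orderOf (B : ProjectiveSpecialLinearGroup (Fin 2) F) = 3 := by
  have main (B : SL(2, F)) (hB : slTrace B = 1) :
      orderOf (B : ProjectiveSpecialLinearGroup (Fin 2) F) = 3 := by
    have h1 : slTrace (1 : SL(2, F)) = 2 := by rw [slOf_one, slTrace_slOf]; norm_num
    refine orderOf_eq_prime ?_ fun h => ?_
    · have hcube : B * B * B = -1 := by
        obtain ⟨p, q, r, s, hd, rfl⟩ := exists_eq_slOf B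
        obtain rfl : s = 1 - p := by rw [slTrace_slOf] at hB; linear_combination hB
        rw [slOf_mul, slOf_mul, slOf_one, neg_slOf, slOf_inj]
        refine ⟨?_, ?_, ?_, ?_⟩
        · linear_combination (-p - 1) * hd
        · linear_combination -q * hd
        · linear_combination -r * hd
        · linear_combination (p - 2) * hd
      rw [pow_three', ← QuotientGroup.mk_mul, ← QuotientGroup.mk_mul, hcube]
      exact (psl_mk_eq_iff (A := 1)).2 (Or.inr rfl) |>.symm
    · rcases (psl_mk_eq_iff (A := 1)).1 h.symm with rfl | rfl
      · exact one_ne_zero (α := F) (by linear_combination hB - h1)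
      · rw [slTrace_neg, h1] at hB
        exact h3 (by linear_combination -hB)
  rcases hB with hB | hB
  · exact main B hB
  · rw [← main (-B) (by rw [slTrace_neg, hB, neg_neg])]
    exact congrArg orderOf (psl_mk_eq_iff.2 (Or.inr rfl))

theorem eq_zero_or_eq_one_of_card_eq_two (h : Nat.card F = 2) (x : F) : x = 0 ∨ x = 1 := by
  have : Finite F := Nat.finite_of_card_ne_zero (by omega)
  have huniv : ({0, 1} : Set F) = Set.univ := by
    apply Set.eq_of_subset_of_ncard_le (Set.subset_univ _)
    rw [Set.ncard_univ, h, Set.ncard_pair zero_ne_one]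
  have := huniv.symm ▸ Set.mem_univ x
  simpa using this

end SpecialLinearGroupTwo

theorem mainTheorem3 (F : Type*) [Field F] [Finite F]
    (C : ConjClasses (Matrix.ProjectiveSpecialLinearGroup (Fin 2) F)) (hC : C.IsReal)
    (h2 : ¬ (Nat.card F = 2 ∧ ∀ a ∈ C.carrier, orderOf a = 3))
    (h3 : ¬ (Nat.card F = 3 ∧ ∀ a ∈ C.carrier, orderOf a = 2)) :
    C.killingForm.Nondegenerate := by
  obtain ⟨x, rfl⟩ := ConjClasses.exists_rep C
  obtain ⟨A, rfl⟩ := QuotientGroup.mk_surjective x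
  have hA : (A : Matrix.ProjectiveSpecialLinearGroup (Fin 2) F) ∈
      (ConjClasses.mk (A : Matrix.ProjectiveSpecialLinearGroup (Fin 2) F)).carrier :=
    ConjClasses.mem_carrier_mk
  change ConjClasses.IsReal (ConjClasses.mk (A : Matrix.ProjectiveSpecialLinearGroup (Fin 2) F))
    at hC
  by_cases hA1 : (A : Matrix.ProjectiveSpecialLinearGroup (Fin 2) F) = 1
  · refine ConjClasses.killingForm_nondegenerate_of_odd _ hC hA hA (u := 1) (by simp)
      fun b hb _ => Or.inl ?_
    have hb' := ConjClasses.mk_eq_mk_iff_isConj.1 (ConjClasses.mem_carrier_iff_mk_eq.1 hb)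
    change IsConj b (A : Matrix.ProjectiveSpecialLinearGroup (Fin 2) F) at hb'
    change b = (A : Matrix.ProjectiveSpecialLinearGroup (Fin 2) F)
    rw [hA1] at hb' ⊢
    exact isConj_one_left.1 hb'
  have hne : A ≠ 1 := by rintro rfl; exact hA1 rfl
  have hne' : -A ≠ 1 := fun h => hA1 ((psl_mk_eq_iff (A := 1)).2 (Or.inr (by rw [← h, neg_neg]))).symm
  by_cases hchar : (2 : F) = 0
  · by_cases ht : slTrace A = 0
    · exact psl_killingForm_nondegenerate_of_slTrace_eq_two hC hA (ht.trans hchar.symm) hne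
    · refine psl_killingForm_nondegenerate_of_slTrace_ne_zero hchar (fun hF => h2 ⟨hF, ?_⟩) hC hA ht
      intro b hb
      obtain ⟨B, rfl⟩ := QuotientGroup.mk_surjective b
      have ht1 := (eq_zero_or_eq_one_of_card_eq_two hF (slTrace A)).resolve_left ht
      have := slTrace_eq_or_eq_neg_of_mem_carrier hA hb
      rw [ht1] at this
      exact psl_orderOf_eq_three (fun h => one_ne_zero (α := F) (by linear_combination h - hchar)) this
  · by_cases ht : slTrace A = 0
    · refine psl_killingForm_nondegenerate_of_slTrace_eq_zero hchar (fun hF => h3 ⟨hF, ?_⟩) hC hA ht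
      intro b hb
      obtain ⟨B, rfl⟩ := QuotientGroup.mk_surjective b
      have := slTrace_eq_or_eq_neg_of_mem_carrier hA hb
      rw [ht, neg_zero, or_self] at this
      exact psl_orderOf_eq_two hchar this
    · by_cases ht4 : slTrace A ^ 2 = 4
      · rcases eq_or_eq_neg_of_sq_eq_sq (slTrace A) 2 (by rw [ht4]; norm_num) with ht2 | ht2
        · exact psl_killingForm_nondegenerate_of_slTrace_eq_two hC hA ht2 hne
        -- `A` and `-A` have the same image in `PSL₂`, so trace `-2` reduces to trace `2`.
        · refine psl_killingForm_nondegenerate_of_slTrace_eq_two (A := -A) hC ?_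
            (by rw [slTrace_neg, ht2, neg_neg]) hne'
          rwa [← psl_mk_eq_iff.2 (Or.inr rfl : -A = A ∨ -A = -A)]
      · exact psl_killingForm_nondegenerate_of_slTrace_sq_ne_four hchar hC hA ht ht4
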